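/- Let $\mathbb{H}=\{\tau\in\mathbb{C} : \operatorname{Im}\tau>0\}$. For $(\epsilon,\epsilon')\in\mathbb{R}^2$, $\zeta\in\mathbb{C}$ and $\tau\in\mathbb{H}$ put $$\theta\begin{bmatrix}\epsilon\\ \epsilon'\end{bmatrix}(\zeta,\tau)=\sum_{n\in\mathbb{Z}}\exp\left(2\pi i\left[\frac12\left(n+\frac{\epsilon}{2}\right)^2\tau+\left(n+\frac{\epsilon}{2}\right)\left(\zeta+\frac{\epsilon'}{2}\right)\right]\right),$$ and let the theta constant $\theta\begin{bmatrix}\epsilon\\ \epsilon'\end{bmatrix}$ be the function $\tau\mapsto\theta\begin{bmatrix}\epsilon\\ \epsilon'\end{bmatrix}(0,\tau)$ on $\mathbb{H}$. Among the twelve theta constants $$\theta\begin{bmatrix}j/5\\ k/5\end{bmatrix},\qquad \theta\begin{bmatrix}1\\ j/5\end{bmatrix}\qquad (j=1,3;\ k=1,3,5,7,9),$$ at most five are algebraically independent over $\mathbb{C}$; that is, every subfamily of these twelve functions on $\mathbb{H}$ that is algebraically independent over $\mathbb{C}$ has at most five members. -/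

import Mathlib

/-- The `n`-th term of the series of the theta function with characteristic `[ε; ε']`. -/
noncomputable def thetaCharTerm (ε ε' : ℝ) (ζ τ : ℂ) (n : ℤ) : ℂ :=
  Complex.exp (2 * (Real.pi : ℂ) * Complex.I *
    ((1 / 2 : ℂ) * ((n : ℂ) + (ε : ℂ) / 2) ^ 2 * τ
      + ((n : ℂ) + (ε : ℂ) / 2) * (ζ + (ε' : ℂ) / 2)))

/-- The theta function `θ[ε; ε'](ζ, τ)` with real characteristic `[ε; ε']`, for `ζ ∈ ℂ` and
`τ` in the upper half-plane. The series converges absolutely, see `summable_thetaCharTerm`. -/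
noncomputable def thetaChar (ε ε' : ℝ) (ζ : ℂ) (τ : UpperHalfPlane) : ℂ :=
  ∑' n : ℤ, thetaCharTerm ε ε' ζ (τ : ℂ) n

theorem summable_thetaCharTerm (ε ε' : ℝ) (ζ : ℂ) (τ : UpperHalfPlane) :
    Summable (thetaCharTerm ε ε' ζ (τ : ℂ)) := by
  have h := ((summable_jacobiTheta₂_term_iff
    ((ε : ℂ) / 2 * (τ : ℂ) + (ζ + (ε' : ℂ) / 2)) (τ : ℂ)).2 τ.im_pos).mul_left
    (Complex.exp (2 * (Real.pi : ℂ) * Complex.I *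
      ((1 / 2 : ℂ) * ((ε : ℂ) / 2) ^ 2 * (τ : ℂ) + ((ε : ℂ) / 2) * (ζ + (ε' : ℂ) / 2))))
  refine h.congr fun n => ?_
  rw [thetaCharTerm, jacobiTheta₂_term, ← Complex.exp_add]
  congr 1
  ring

/-- The theta constant `θ[ε; ε'] = θ[ε; ε'](0, τ)`, as a function of `τ` in the upper
half-plane. -/
noncomputable def thetaConst (ε ε' : ℝ) : UpperHalfPlane → ℂ :=
  fun τ => thetaChar ε ε' 0 τ

/-- The twelve theta constants of level five: `θ[j/5; k/5]` with `j ∈ {1, 3}` and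
`k ∈ {1, 3, 5, 7, 9}`, and `θ[1; j/5]` with `j ∈ {1, 3}`. The index `a : Fin 2` stands for
`j = 2 a + 1` and the index `b : Fin 5` stands for `k = 2 b + 1`. -/
noncomputable def levelFiveThetaConst : (Fin 2 × Fin 5) ⊕ Fin 2 → (UpperHalfPlane → ℂ)
  | Sum.inl (a, b) =>
      thetaConst ((2 * ((a : ℕ) : ℝ) + 1) / 5) ((2 * ((b : ℕ) : ℝ) + 1) / 5)
  | Sum.inr a => thetaConst 1 ((2 * ((a : ℕ) : ℝ) + 1) / 5)

/-!
The twelve theta constants even generate an algebra of transcendence degree at most two: each of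
them is algebraic over `ℂ[a, b]`, where `a = θ[0; 0](2τ)` and `b = θ[1; 0](2τ)`.

For a point `(ε τ + ε') / 2` of the elliptic curve `ℂ / (ℤ + ℤ τ)` consider its Kummer coordinates
`A = θ[ε; 2ε'](2τ)` and `B = θ[ε + 1; 2ε'](2τ)`; the origin has coordinates `(a, b)`. The product
formula `thetaNull_mul_thetaNull` writes a product of two theta constants at `τ` as a bilinear
expression in theta constants at `2τ`. Among its special cases are

* `θ[ε; ε'] ^ 2 = a A + b B`, and the same with `a A - b B` for `θ[ε; ε' + 1] ^ 2` and `b A - a B`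
  for `θ[ε + 1; ε' + 1] ^ 2`, up to constants;
* `θ[2ε; 2ε'] θ[0; 0] = A ^ 2 + B ^ 2`, and the same with `A ^ 2 - B ^ 2` for
  `θ[2ε; 2ε' + 1] θ[0; 1]`, up to a constant.

Eliminating the theta constants at `τ` expresses the coordinates of the doubled point as quartic
forms in `A` and `B` with coefficients in `ℂ(a, b)` (`kummerDouble_kummer`).

Up to signs and lattice vectors, doubling a point of order five twice gives the point itself, so
that two duplications multiply `(A, B)` by a constant. Two duplications are not the identity of the
projective line, as they send `(a : -b)`, a point of order two, to the origin `(a : b)`. Hence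
`A / B` is a root of a nonzero polynomial over `ℂ[a, b]`; and as two duplications are homogeneous of
degree `16`, the fifteenth power of the scale is algebraic as well
(`isAlgebraic_adjoin_of_kummerDouble`). The twelve theta constants are the `θ[ε + 1; ε' + 1]` for
points of order five, so their squares are linear forms in `A` and `B`.

All of this takes place in the domain of holomorphic functions on the upper half-plane.
-/

open Complex
open scoped Manifold UpperHalfPlane

universe v

/-! ### Theta constants and their product formula -/

/-- The theta constant as a function on all of `ℂ`, so that it can be evaluated at `2 * τ`. -/
noncomputable def thetaNull (ε ε' : ℝ) (τ : ℂ) : ℂ :=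
  ∑' n : ℤ, thetaCharTerm ε ε' 0 τ n

theorem thetaConst_apply (ε ε' : ℝ) (τ : UpperHalfPlane) :
    thetaConst ε ε' τ = thetaNull ε ε' τ := rfl

theorem hasSum_thetaNull (ε ε' : ℝ) {τ : ℂ} (hτ : 0 < τ.im) :
    HasSum (thetaCharTerm ε ε' 0 τ) (thetaNull ε ε' τ) :=
  (summable_thetaCharTerm ε ε' 0 ⟨τ, hτ⟩).hasSum

/-- Pairs of integers `(n, m)` are split by the parity of `n - m`: either
`(n, m) = (k + l, k - l)` or `(n, m) = (k + l + 1, k - l)`. -/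
noncomputable def parityEquiv : (ℤ × ℤ) ⊕ (ℤ × ℤ) ≃ ℤ × ℤ :=
  Equiv.ofBijective
    (Sum.elim (fun p => (p.1 + p.2, p.1 - p.2)) (fun p => (p.1 + p.2 + 1, p.1 - p.2))) <| by
    constructor
    · rintro (⟨a, b⟩ | ⟨a, b⟩) (⟨c, d⟩ | ⟨c, d⟩) h <;>
        simp only [Sum.elim_inl, Sum.elim_inr, Prod.mk.injEq, Sum.inl.injEq, Sum.inr.injEq,
          reduceCtorEq] at h ⊢ <;> omega
    · rintro ⟨n, m⟩
      rcases Int.even_or_odd (n - m) with ⟨l, hl⟩ | ⟨l, hl⟩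
      · exact ⟨Sum.inl (m + l, l), by ext <;> simp; omega⟩
      · exact ⟨Sum.inr (m + l, l), by ext <;> simp; omega⟩

theorem parityEquiv_inl (p : ℤ × ℤ) : parityEquiv (Sum.inl p) = (p.1 + p.2, p.1 - p.2) := rfl

theorem parityEquiv_inr (p : ℤ × ℤ) : parityEquiv (Sum.inr p) = (p.1 + p.2 + 1, p.1 - p.2) := rfl

/-- The product formula: after splitting the double series by parity, a product of two theta
constants at `τ` is bilinear in theta constants at `2 * τ`. -/
theorem thetaNull_mul_thetaNull (ε δ α β : ℝ) {τ : ℂ} (hτ : 0 < τ.im) :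
    thetaNull ε α τ * thetaNull δ β τ =
      thetaNull ((ε + δ) / 2) (α + β) (2 * τ) * thetaNull ((ε - δ) / 2) (α - β) (2 * τ) +
      thetaNull ((ε + δ) / 2 + 1) (α + β) (2 * τ) *
        thetaNull ((ε - δ) / 2 + 1) (α - β) (2 * τ) := by
  have h2 : 0 < (2 * τ).im := by simpa using hτ
  have mul : ∀ (x y x' y' : ℝ) {σ : ℂ}, 0 < σ.im → HasSum (fun p : ℤ × ℤ =>
      thetaCharTerm x y 0 σ p.1 * thetaCharTerm x' y' 0 σ p.2)
      (thetaNull x y σ * thetaNull x' y' σ) := fun x y x' y' σ hσ => by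
    have hf := hasSum_thetaNull x y hσ
    have hg := hasSum_thetaNull x' y' hσ
    exact hf.mul hg (summable_mul_of_summable_norm hf.summable.norm hg.summable.norm)
  have key := (mul ((ε + δ) / 2) (α + β) ((ε - δ) / 2) (α - β) h2)
  have key' := (mul ((ε + δ) / 2 + 1) (α + β) ((ε - δ) / 2 + 1) (α - β) h2)
  refine (parityEquiv.hasSum_iff.2 (mul ε α δ β hτ)).unique (HasSum.sum ?_ ?_)
  · convert key using 1
    funext p
    simp only [Function.comp, parityEquiv_inl, thetaCharTerm,
      ← Complex.exp_add]
    congr 1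
    push_cast
    ring
  · convert key' using 1
    funext p
    simp only [Function.comp, parityEquiv_inr, thetaCharTerm,
      ← Complex.exp_add]
    congr 1
    push_cast
    ring

theorem thetaNull_add_two_mul_int (ε ε' : ℝ) (m : ℤ) (τ : ℂ) :
    thetaNull (ε + 2 * m) ε' τ = thetaNull ε ε' τ := by
  rw [thetaNull, thetaNull, ← (Equiv.addRight m).tsum_eq (thetaCharTerm ε ε' 0 τ)]
  refine tsum_congr fun n => ?_
  simp only [thetaCharTerm, Equiv.coe_addRight]
  congr 1
  push_cast
  ring

theorem thetaNull_neg (ε ε' : ℝ) (τ : ℂ) : thetaNull (-ε) (-ε') τ = thetaNull ε ε' τ := by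
  rw [thetaNull, thetaNull, ← (Equiv.neg ℤ).tsum_eq (thetaCharTerm ε ε' 0 τ)]
  refine tsum_congr fun n => ?_
  simp only [thetaCharTerm, Equiv.neg_apply]
  congr 1
  push_cast
  ring

theorem thetaNull_add_two_mul_int_right (ε ε' : ℝ) (m : ℤ) (τ : ℂ) :
    thetaNull ε (ε' + 2 * m) τ = exp (Real.pi * I * m * ε) * thetaNull ε ε' τ := by
  rw [thetaNull, thetaNull, ← tsum_mul_left]
  refine tsum_congr fun n => ?_
  simp only [thetaCharTerm]
  rw [← Complex.exp_add, Complex.exp_eq_exp_iff_exists_int]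
  refine ⟨n * m, ?_⟩
  push_cast
  ring

/-- A theta constant does not vanish at a point where all terms of its series are positive. -/
theorem thetaNull_ne_zero_of_pos {ε ε' : ℝ} {τ : ℂ} (hτ : 0 < τ.im) {r : ℤ → ℝ}
    (hr : ∀ n, 0 < r n) (h : ∀ n, thetaCharTerm ε ε' 0 τ n = r n) : thetaNull ε ε' τ ≠ 0 := by
  have hs := (hasSum_thetaNull ε ε' hτ).summable
  rw [funext h] at hs
  rw [thetaNull, tsum_congr h, ← Complex.ofReal_tsum]
  exact_mod_cast ((Complex.summable_ofReal.1 hs).tsum_pos (fun n => (hr n).le) 0 (hr 0)).ne'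

theorem thetaNull_zero_right_ne_zero (ε : ℝ) {y : ℝ} (hy : 0 < y) :
    thetaNull ε 0 (y * I) ≠ 0 := by
  refine thetaNull_ne_zero_of_pos (r := fun n => Real.exp (-Real.pi * (n + ε / 2) ^ 2 * y))
    (by simpa using hy) (fun n => Real.exp_pos _) fun n => ?_
  rw [thetaCharTerm, Complex.ofReal_exp]
  congr 1
  push_cast
  linear_combination (Real.pi * (n + ε / 2) ^ 2 * y : ℂ) * I_mul_I

/-- At `τ = 1 + i` the signs `(-1) ^ n` of `θ[0; 1]` are cancelled by those of
`exp (π i n ^ 2 τ)`. -/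
theorem thetaNull_zero_one_ne_zero : thetaNull 0 1 (1 + I) ≠ 0 := by
  refine thetaNull_ne_zero_of_pos (r := fun n => Real.exp (-Real.pi * n ^ 2))
    (by simp) (fun n => Real.exp_pos _) fun n => ?_
  obtain ⟨k, hk⟩ := Int.even_mul_succ_self n
  have hk' : (n : ℂ) * (n + 1) = k + k := by exact_mod_cast hk
  rw [thetaCharTerm, Complex.ofReal_exp, Complex.exp_eq_exp_iff_exists_int]
  refine ⟨k, ?_⟩
  push_cast
  linear_combination (Real.pi * n ^ 2 : ℂ) * I_mul_I + (Real.pi * I) * hk'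

theorem thetaNull_eq_jacobiTheta₂ (ε ε' : ℝ) (τ : ℂ) : thetaNull ε ε' τ =
    exp (2 * Real.pi * I * ((ε / 2) ^ 2 * τ / 2 + ε / 2 * (ε' / 2))) *
      jacobiTheta₂ (ε / 2 * τ + ε' / 2) τ := by
  rw [thetaNull, jacobiTheta₂, ← tsum_mul_left]
  refine tsum_congr fun n => ?_
  rw [thetaCharTerm, jacobiTheta₂_term, ← Complex.exp_add]
  congr 1
  ring

theorem differentiableAt_thetaNull (ε ε' : ℝ) {τ : ℂ} (hτ : 0 < τ.im) :
    DifferentiableAt ℂ (thetaNull ε ε') τ := by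
  rw [funext (thetaNull_eq_jacobiTheta₂ ε ε')]
  refine DifferentiableAt.mul (by fun_prop) ?_
  have h := (hasFDerivAt_jacobiTheta₂ (ε / 2 * τ + ε' / 2) hτ).differentiableAt
  exact h.comp (f := fun σ : ℂ => ((ε / 2 * σ + ε' / 2 : ℂ), σ)) τ (by fun_prop)

/-! ### Doubling in Kummer coordinates -/

section Doubling

variable {S : Type*} [CommRing S]

/-- Duplication in the Kummer coordinates `p = (A, B)` of an elliptic curve whose origin has
coordinates `(a, b)`. It is multiplied by `2 * a * b * (a ^ 4 - b ^ 4)` to clear denominators. -/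
def kummerDouble (a b : S) (p : S × S) : S × S :=
  (b * ((a ^ 2 - b ^ 2) * (p.1 ^ 2 + p.2 ^ 2) ^ 2 + (a ^ 2 + b ^ 2) * (p.1 ^ 2 - p.2 ^ 2) ^ 2),
    a * ((a ^ 2 - b ^ 2) * (p.1 ^ 2 + p.2 ^ 2) ^ 2 - (a ^ 2 + b ^ 2) * (p.1 ^ 2 - p.2 ^ 2) ^ 2))

theorem kummerDouble_smul (a b c : S) (p : S × S) :
    kummerDouble a b (c • p) = c ^ 4 • kummerDouble a b p := by
  ext <;> simp only [kummerDouble, Prod.smul_fst, Prod.smul_snd, smul_eq_mul] <;> ring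

theorem kummerDouble_kummerDouble_smul (a b c : S) (p : S × S) :
    kummerDouble a b (kummerDouble a b (c • p)) =
      c ^ 16 • kummerDouble a b (kummerDouble a b p) := by
  rw [kummerDouble_smul, kummerDouble_smul, ← pow_mul]

/-- The origin is fixed by duplication. -/
theorem kummerDouble_origin (a b : S) :
    kummerDouble a b (a, b) = (2 * a * b * (a ^ 4 - b ^ 4)) • (a, b) := by
  ext <;> simp only [kummerDouble, Prod.smul_fst, Prod.smul_snd, smul_eq_mul] <;> ring

/-- The point `(a, -b)` has order two. -/
theorem kummerDouble_two_torsion (a b : S) :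
    kummerDouble a b (a, -b) = (2 * a * b * (a ^ 4 - b ^ 4)) • (a, b) := by
  ext <;> simp only [kummerDouble, Prod.smul_fst, Prod.smul_snd, smul_eq_mul] <;> ring

theorem map_kummerDouble {T F : Type*} [CommRing T] [FunLike F S T] [RingHomClass F S T] (f : F)
    (a b : S) (p : S × S) :
    Prod.map f f (kummerDouble a b p) = kummerDouble (f a) (f b) (Prod.map f f p) := by
  ext <;> simp [kummerDouble]

end Doubling

section Algebraic

variable {R K : Type*} [CommRing R] [IsDomain R] [Field K] [Algebra R K]

open Polynomial

theorem isAlgebraic_kummerDouble (a b : R) {p : K × K} (h₁ : IsAlgebraic R p.1)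
    (h₂ : IsAlgebraic R p.2) :
    IsAlgebraic R (kummerDouble (algebraMap R K a) (algebraMap R K b) p).1 ∧
      IsAlgebraic R (kummerDouble (algebraMap R K a) (algebraMap R K b) p).2 := by
  have ha : IsAlgebraic R (algebraMap R K a) := isAlgebraic_algebraMap a
  have hb : IsAlgebraic R (algebraMap R K b) := isAlgebraic_algebraMap b
  have hs : IsAlgebraic R (algebraMap R K a ^ 2 + algebraMap R K b ^ 2) := (ha.pow 2).add (hb.pow 2)
  have hd : IsAlgebraic R (algebraMap R K a ^ 2 - algebraMap R K b ^ 2) := (ha.pow 2).sub (hb.pow 2)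
  have hs' := hd.mul (((h₁.pow 2).add (h₂.pow 2)).pow 2)
  have hd' := hs.mul (((h₁.pow 2).sub (h₂.pow 2)).pow 2)
  exact ⟨hb.mul (hs'.add hd'), ha.mul (hs'.sub hd')⟩

/-- The scale of coordinates with algebraic ratio is determined up to a fifteenth root, as two
duplications are homogeneous of degree `16`. -/
theorem isAlgebraic_of_pow_mul_eq [FaithfulSMul R K] {ν : R} (hν : ν ≠ 0) {c g : K} (hc : c ≠ 0)
    (hg : IsAlgebraic R g) (h : c ^ 16 * g = algebraMap R K ν * c) : IsAlgebraic R c := by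
  have h15 : c ^ 15 * g = algebraMap R K ν := by
    apply mul_right_cancel₀ hc
    rw [← h]
    ring
  have hν' : algebraMap R K ν ≠ 0 := by
    rwa [Ne, FaithfulSMul.algebraMap_eq_zero_iff]
  have hg0 : g ≠ 0 := fun h0 => hν' (by rw [← h15, h0, mul_zero])
  refine IsAlgebraic.of_pow (n := 15) (by norm_num) ?_
  rw [eq_div_of_mul_eq hg0 h15, div_eq_mul_inv]
  exact (isAlgebraic_algebraMap ν).mul hg.inv

/-- Projective coordinates fixed up to a factor by two duplications are algebraic: their ratio is a
root of a nonzero polynomial, and then so is their scale. -/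
theorem isAlgebraic_of_kummerDouble_kummerDouble [FaithfulSMul R K] {a b ν : R}
    (hw : 2 * a * b * (a ^ 4 - b ^ 4) ≠ 0) (hν : ν ≠ 0) (p : K × K)
    (h : kummerDouble (algebraMap R K a) (algebraMap R K b)
      (kummerDouble (algebraMap R K a) (algebraMap R K b) p) = algebraMap R K ν • p) :
    IsAlgebraic R p.1 ∧ IsAlgebraic R p.2 := by
  obtain ⟨A, B⟩ := p
  by_cases hB : B = 0
  · -- The ratio `A / B` is infinite, so only the scale `A` is left.
    subst hB
    by_cases hA : A = 0
    · subst hA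
      exact ⟨isAlgebraic_zero, isAlgebraic_zero⟩
    have e : ((A, 0) : K × K) = A • (1, 0) := by simp
    rw [e, kummerDouble_kummerDouble_smul] at h
    have hD := isAlgebraic_kummerDouble a b (p := ((1, 0) : K × K)) isAlgebraic_one isAlgebraic_zero
    refine ⟨isAlgebraic_of_pow_mul_eq hν hA (isAlgebraic_kummerDouble a b hD.1 hD.2).1 ?_,
      isAlgebraic_zero⟩
    simpa only [Prod.smul_fst, smul_eq_mul, mul_one] using congrArg Prod.fst h
  · set t := A / B with ht
    have e : ((A, B) : K × K) = B • (t, 1) := by simp [ht, mul_div_cancel₀ _ hB]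
    have talg : IsAlgebraic R t := by
      -- The generic point `(X : 1)` duplicated twice; the ratio `t` is a fixed point of `q.1 / q.2`.
      let q : R[X] × R[X] := kummerDouble (C a) (C b) (kummerDouble (C a) (C b) (X, 1))
      have hq : ∀ u : K, Prod.map (aeval u) (aeval u) q =
          kummerDouble (algebraMap R K a) (algebraMap R K b)
            (kummerDouble (algebraMap R K a) (algebraMap R K b) (u, 1)) := fun u => by
        simp only [q, map_kummerDouble, aeval_C, Prod.map_apply, aeval_X, map_one]
      refine ⟨q.1 - X * q.2, fun h0 => ?_, ?_⟩
      · -- Two duplications are not the identity: they send `(a : -b)` to `(a : b)`.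
        have hab : 2 * a * b ≠ 0 := left_ne_zero_of_mul hw
        have hb : algebraMap R K b ≠ 0 := by
          rw [Ne, FaithfulSMul.algebraMap_eq_zero_iff]
          exact right_ne_zero_of_mul hab
        set a' := algebraMap R K a
        set b' := algebraMap R K b
        have hw' : 2 * a' * b' * (a' ^ 4 - b' ^ 4) ≠ 0 := by
          have := (FaithfulSMul.algebraMap_eq_zero_iff R K).not.2 hw
          rwa [map_mul, map_mul, map_mul, map_sub, map_pow, map_pow, map_ofNat] at this
        set w := 2 * a' * b' * (a' ^ 4 - b' ^ 4)
        have h1 := hq (-a' / b')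
        have e1 : ((a', -b') : K × K) = (-b') • (-a' / b', 1) := by
          ext <;> simp; field_simp
        have h2 := kummerDouble_kummerDouble_smul a' b' (-b') (-a' / b', 1)
        rw [← e1, kummerDouble_two_torsion, kummerDouble_smul, kummerDouble_origin, ← h1] at h2
        have h3 := congrArg Prod.fst h2
        have h4 := congrArg Prod.snd h2
        simp only [Prod.smul_fst, Prod.smul_snd, smul_eq_mul, Prod.map_fst, Prod.map_snd] at h3 h4
        have h5 := congrArg (aeval (-a' / b')) h0
        simp only [map_sub, map_mul, aeval_X, map_zero] at h5
        have h6 : w ^ 4 * (w * a') * b' + a' * (w ^ 4 * (w * b')) = 0 := by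
          rw [h3, h4]
          have : aeval (-a' / b') q.1 * b' + a' * aeval (-a' / b') q.2 = 0 := by
            rw [sub_eq_zero.1 h5]
            field_simp
            ring
          linear_combination (-b') ^ 16 * this
        have h7 : w ^ 5 * (2 * a' * b') = 0 := by linear_combination h6
        exact mul_ne_zero (pow_ne_zero 5 hw') (left_ne_zero_of_mul hw') h7
      · have h1 := hq t
        rw [e, kummerDouble_kummerDouble_smul, ← h1] at h
        have h3 := congrArg Prod.fst h
        have h4 := congrArg Prod.snd h
        simp only [Prod.smul_fst, Prod.smul_snd, smul_eq_mul, Prod.map_fst, Prod.map_snd] at h3 h4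
        simp only [map_sub, map_mul, aeval_X]
        apply mul_left_cancel₀ (pow_ne_zero 16 hB)
        linear_combination h3 - t * h4
    rw [e, kummerDouble_kummerDouble_smul] at h
    have hD := isAlgebraic_kummerDouble a b (p := (t, 1)) talg isAlgebraic_one
    have hBalg : IsAlgebraic R B :=
      isAlgebraic_of_pow_mul_eq hν hB (isAlgebraic_kummerDouble a b hD.1 hD.2).2
        (by simpa only [Prod.smul_snd, smul_eq_mul, mul_one] using congrArg Prod.snd h)
    refine ⟨?_, hBalg⟩
    exact div_mul_cancel₀ A hB ▸ talg.mul hBalg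

theorem isAlgebraic_of_kummerDouble_of_isDomain {H : Type*} [CommRing H] [IsDomain H] [Algebra R H]
    [FaithfulSMul R H] {a b ν : R} (hw : 2 * a * b * (a ^ 4 - b ^ 4) ≠ 0) (hν : ν ≠ 0) (p : H × H)
    (h : kummerDouble (algebraMap R H a) (algebraMap R H b)
      (kummerDouble (algebraMap R H a) (algebraMap R H b) p) = algebraMap R H ν • p) :
    IsAlgebraic R p.1 ∧ IsAlgebraic R p.2 := by
  have inj : Function.Injective (algebraMap H (FractionRing H)) :=
    FaithfulSMul.algebraMap_injective _ _
  have : FaithfulSMul R (FractionRing H) := by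
    rw [faithfulSMul_iff_algebraMap_injective, IsScalarTower.algebraMap_eq R H]
    exact inj.comp (FaithfulSMul.algebraMap_injective R H)
  have h' := congrArg (Prod.map (algebraMap H (FractionRing H)) (algebraMap H (FractionRing H))) h
  rw [map_kummerDouble, map_kummerDouble, ← IsScalarTower.algebraMap_apply,
    ← IsScalarTower.algebraMap_apply] at h'
  have key := isAlgebraic_of_kummerDouble_kummerDouble (K := FractionRing H) hw hν _
    (h'.trans (by
      ext1 <;> simp [Algebra.smul_def, IsScalarTower.algebraMap_apply R H (FractionRing H)]))
  exact ⟨(isAlgebraic_algebraMap_iff inj).1 key.1, (isAlgebraic_algebraMap_iff inj).1 key.2⟩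

/-- Kummer coordinates of a point fixed projectively by two duplications are algebraic over the
coordinates of the origin. -/
theorem isAlgebraic_adjoin_of_kummerDouble {k H : Type*} [Field k] [CommRing H] [IsDomain H]
    [Algebra k H] {a b : H} (hw : 2 * a * b * (a ^ 4 - b ^ 4) ≠ 0) {ζ : k} (hζ : ζ ≠ 0) (p : H × H)
    (h : kummerDouble a b (kummerDouble a b p) = (2 * a * b * (a ^ 4 - b ^ 4)) ^ 5 • ζ • p) :
    IsAlgebraic (Algebra.adjoin k {a, b}) p.1 ∧ IsAlgebraic (Algebra.adjoin k {a, b}) p.2 := by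
  let a' : Algebra.adjoin k {a, b} := ⟨a, Algebra.subset_adjoin (Set.mem_insert _ _)⟩
  let b' : Algebra.adjoin k {a, b} := ⟨b, Algebra.subset_adjoin (Set.mem_insert_of_mem _ rfl)⟩
  have hw' : 2 * a' * b' * (a' ^ 4 - b' ^ 4) ≠ 0 := fun h0 => hw (congrArg Subtype.val h0)
  refine isAlgebraic_of_kummerDouble_of_isDomain (a := a') (b := b')
    (ν := (2 * a' * b' * (a' ^ 4 - b' ^ 4)) ^ 5 * algebraMap k _ ζ) hw'
    (mul_ne_zero (pow_ne_zero 5 hw') ?_) p (h.trans ?_)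
  · rwa [Ne, FaithfulSMul.algebraMap_eq_zero_iff]
  · have e : algebraMap (Algebra.adjoin k {a, b}) H
        ((2 * a' * b' * (a' ^ 4 - b' ^ 4)) ^ 5 * algebraMap k _ ζ) =
          (2 * a * b * (a ^ 4 - b ^ 4)) ^ 5 * algebraMap k H ζ := rfl
    rw [e, mul_smul, algebraMap_smul]

end Algebraic

/-! ### Transcendence degree -/

open Cardinal Algebra

/-- The elements algebraic over `R` form a domain of the same transcendence degree as `R`. -/
theorem AlgebraicIndependent.lift_cardinalMk_le_trdeg_of_isAlgebraic {k : Type*} {R H : Type v}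
    {ι : Type*} [Field k] [CommRing R] [IsDomain R] [CommRing H] [IsDomain H] [Algebra k R]
    [Algebra R H] [Algebra k H] [IsScalarTower k R H] [FaithfulSMul R H] {x : ι → H}
    (hx : AlgebraicIndependent k x) (halg : ∀ i, IsAlgebraic R (x i)) :
    lift.{v} #ι ≤ lift (trdeg k R) := by
  let L := Subalgebra.algebraicClosure R H
  have : FaithfulSMul R L := (faithfulSMul_iff_algebraMap_injective R L).2 fun r r' h =>
    FaithfulSMul.algebraMap_injective R H (congrArg Subtype.val h)
  have hL : trdeg k R + trdeg R L = trdeg k L := trdeg_add_eq k R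
  have h0 : trdeg R L = 0 := trdeg_eq_zero
  rw [h0, add_zero] at hL
  have hy : AlgebraicIndependent k (fun i => (⟨x i, halg i⟩ : L)) :=
    AlgebraicIndependent.of_comp (L.restrictScalars k).val hx
  rw [hL]
  exact hy.lift_cardinalMk_le_trdeg

/-- Elements of a domain that are algebraic over a subalgebra generated by two elements form no
algebraically independent family with more than two members. -/
theorem AlgebraicIndependent.card_le_two_of_isAlgebraic_adjoin_pair {k : Type*} {H : Type v}
    {ι : Type*} [Field k] [CommRing H] [IsDomain H] [Algebra k H] [Fintype ι] {a b : H} {x : ι → H}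
    (hx : AlgebraicIndependent k x) (halg : ∀ i, IsAlgebraic (Algebra.adjoin k {a, b}) (x i)) :
    Fintype.card ι ≤ 2 := by
  have h := lift_trdeg_le_of_surjective _ (AlgHom.rangeRestrict_surjective
    (MvPolynomial.aeval ((↑) : ({a, b} : Set H) → H) : MvPolynomial ({a, b} : Set H) k →ₐ[k] H))
  rw [← Algebra.adjoin_eq_range, MvPolynomial.trdeg_of_isDomain] at h
  have h2 : #({a, b} : Set H) ≤ 2 := by
    classical
    simpa using (Finset.card_le_two (a := a) (b := b))
  have h'' : trdeg k (Algebra.adjoin k {a, b}) ≤ #({a, b} : Set H) := by simpa using h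
  have h' := hx.lift_cardinalMk_le_trdeg_of_isAlgebraic halg
  simpa using h'.trans (lift_le.2 (h''.trans h2))

/-! ### Kummer coordinates as holomorphic functions -/

theorem mdifferentiable_thetaNull (ε ε' : ℝ) :
    MDiff (fun τ : ℍ => thetaNull ε ε' τ) := fun τ =>
  (differentiableAt_thetaNull ε ε' τ.im_pos).mdifferentiableAt.comp τ
    (UpperHalfPlane.mdifferentiable_coe τ)

theorem mdifferentiable_thetaNull_two_mul (ε ε' : ℝ) :
    MDiff (fun τ : ℍ => thetaNull ε ε' (2 * τ)) := fun τ => by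
  have h : 0 < (2 * (τ : ℂ)).im := by simpa using τ.im_pos
  have h' : DifferentiableAt ℂ (fun z : ℂ => thetaNull ε ε' (2 * z)) (τ : ℂ) :=
    (differentiableAt_thetaNull ε ε' h).comp (τ : ℂ) (by fun_prop)
  exact h'.mdifferentiableAt.comp τ (UpperHalfPlane.mdifferentiable_coe τ)

/-- The algebra of holomorphic functions on the upper half-plane. -/
def holomorphicFunctions : Subalgebra ℂ (ℍ → ℂ) where
  carrier := {f | MDiff f}
  mul_mem' hf hg := hf.mul hg
  add_mem' hf hg := hf.add hg
  algebraMap_mem' _ := mdifferentiable_const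

instance : IsDomain holomorphicFunctions := by
  have : NoZeroDivisors holomorphicFunctions := ⟨fun {f g} h => by
    have h' : (f : ℍ → ℂ) * g = 0 := congrArg Subtype.val h
    exact ((UpperHalfPlane.mul_eq_zero_iff f.2 g.2).1 h').imp Subtype.ext Subtype.ext⟩
  exact NoZeroDivisors.to_isDomain _

/-- The first Kummer coordinate of the point `(ε τ + ε') / 2` of `ℂ / (ℤ + ℤ τ)`, scaled by an
exponential factor so that it depends on `(ε, ε')` modulo `2` up to a constant only. -/
noncomputable def kummerFst (ε ε' : ℝ) : holomorphicFunctions :=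
  ⟨fun τ => thetaNull ε (2 * ε') (2 * τ), mdifferentiable_thetaNull_two_mul _ _⟩

/-- The second Kummer coordinate of the point `(ε τ + ε') / 2` of `ℂ / (ℤ + ℤ τ)`, scaled by the same
factor as `kummerFst`. -/
noncomputable def kummerSnd (ε ε' : ℝ) : holomorphicFunctions :=
  ⟨fun τ => thetaNull (ε + 1) (2 * ε') (2 * τ), mdifferentiable_thetaNull_two_mul _ _⟩

/-- The theta constant as an element of the algebra of holomorphic functions. -/
noncomputable def thetaHol (ε ε' : ℝ) : holomorphicFunctions :=
  ⟨thetaConst ε ε', mdifferentiable_thetaNull ε ε'⟩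

theorem thetaHol_sq (ε ε' : ℝ) : thetaHol ε ε' ^ 2 =
    kummerFst 0 0 * kummerFst ε ε' + kummerSnd 0 0 * kummerSnd ε ε' := by
  ext τ
  have h := thetaNull_mul_thetaNull ε ε ε' ε' τ.im_pos
  have e : (ε + ε) / 2 = ε := by ring
  rw [e, sub_self, zero_div, sub_self, ← two_mul] at h
  change thetaNull ε ε' τ ^ 2 = thetaNull 0 (2 * 0) (2 * τ) * thetaNull ε (2 * ε') (2 * τ) +
    thetaNull (0 + 1) (2 * 0) (2 * τ) * thetaNull (ε + 1) (2 * ε') (2 * τ)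
  rw [pow_two, h, mul_zero]
  ring

theorem kummerFst_add_one_right (ε ε' : ℝ) :
    kummerFst ε (ε' + 1) = exp (Real.pi * I * ε) • kummerFst ε ε' := by
  ext τ
  have := thetaNull_add_two_mul_int_right ε (2 * ε') 1 (2 * τ)
  change thetaNull ε (2 * (ε' + 1)) (2 * τ) = exp (Real.pi * I * ε) * thetaNull ε (2 * ε') (2 * τ)
  rw [mul_add, ← Int.cast_one, this]
  simp

theorem kummerSnd_eq (ε ε' : ℝ) : kummerSnd ε ε' = kummerFst (ε + 1) ε' := rfl

theorem exp_pi_mul_I_mul_add_one (ε : ℝ) :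
    exp (Real.pi * I * (ε + 1 : ℝ)) = -exp (Real.pi * I * ε) := by
  rw [ofReal_add, ofReal_one, mul_add, mul_one, exp_add, exp_pi_mul_I, mul_neg_one]

theorem kummerSnd_add_one_right (ε ε' : ℝ) :
    kummerSnd ε (ε' + 1) = -(exp (Real.pi * I * ε) • kummerSnd ε ε') := by
  rw [kummerSnd_eq, kummerFst_add_one_right, exp_pi_mul_I_mul_add_one, neg_smul, kummerSnd_eq]

theorem kummerFst_add_two (ε ε' : ℝ) : kummerFst (ε + 2) ε' = kummerFst ε ε' := by
  ext τ
  have := thetaNull_add_two_mul_int ε (2 * ε') 1 (2 * τ)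
  rwa [Int.cast_one, mul_one] at this

theorem thetaHol_sq_add_one_right (ε ε' : ℝ) : thetaHol ε (ε' + 1) ^ 2 =
    exp (Real.pi * I * ε) •
      (kummerFst 0 0 * kummerFst ε ε' - kummerSnd 0 0 * kummerSnd ε ε') := by
  rw [thetaHol_sq, kummerFst_add_one_right, kummerSnd_add_one_right, smul_sub,
    mul_smul_comm, ← mul_smul_comm _ (kummerSnd 0 0)]
  ring

theorem thetaHol_sq_add_one_add_one (ε ε' : ℝ) : thetaHol (ε + 1) (ε' + 1) ^ 2 =
    exp (Real.pi * I * ε) •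
      (kummerSnd 0 0 * kummerFst ε ε' - kummerFst 0 0 * kummerSnd ε ε') := by
  have e : kummerSnd (ε + 1) ε' = kummerFst ε ε' := by
    rw [kummerSnd_eq, add_assoc, one_add_one_eq_two, kummerFst_add_two]
  rw [thetaHol_sq_add_one_right, exp_pi_mul_I_mul_add_one, e, ← kummerSnd_eq, neg_smul, ← smul_neg,
    neg_sub]

theorem thetaHol_two_mul (ε ε' : ℝ) : thetaHol (2 * ε) (2 * ε') * thetaHol 0 0 =
    kummerFst ε ε' ^ 2 + kummerSnd ε ε' ^ 2 := by
  ext τ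
  have h := thetaNull_mul_thetaNull (2 * ε) 0 (2 * ε') 0 τ.im_pos
  have e : (2 * ε) / 2 = ε := by ring
  rw [add_zero, sub_zero, add_zero, sub_zero, e, ← pow_two, ← pow_two] at h
  exact h

theorem thetaHol_two_mul_add_one (ε ε' : ℝ) : thetaHol (2 * ε) (2 * ε' + 1) * thetaHol 0 1 =
    exp (Real.pi * I * ε) • (kummerFst ε ε' ^ 2 - kummerSnd ε ε' ^ 2) := by
  have key : thetaHol (2 * ε) (2 * ε' + 1) * thetaHol 0 1 =
      kummerFst ε (ε' + 1) * kummerFst ε ε' + kummerSnd ε (ε' + 1) * kummerSnd ε ε' := by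
    ext τ
    have h := thetaNull_mul_thetaNull (2 * ε) 0 (2 * ε' + 1) 1 τ.im_pos
    have e : (2 * ε) / 2 = ε := by ring
    have e' : 2 * ε' + 1 + 1 = 2 * (ε' + 1) := by ring
    rw [add_zero, sub_zero, add_sub_cancel_right, e, e'] at h
    exact h
  rw [key, kummerFst_add_one_right, kummerSnd_add_one_right, smul_sub, pow_two,
    pow_two, ← smul_mul_assoc, ← smul_mul_assoc]
  ring

/-- Doubling the characteristic acts on Kummer coordinates by the duplication formula. -/
theorem kummerDouble_kummer (ε ε' : ℝ) :
    kummerDouble (kummerFst 0 0) (kummerSnd 0 0) (kummerFst ε ε', kummerSnd ε ε') =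
      (2 * kummerFst 0 0 * kummerSnd 0 0 * (kummerFst 0 0 ^ 4 - kummerSnd 0 0 ^ 4)) •
        (kummerFst (2 * ε) (2 * ε'), kummerSnd (2 * ε) (2 * ε')) := by
  have h₁ := thetaHol_sq (2 * ε) (2 * ε')
  have h₂ := thetaHol_sq_add_one_right (2 * ε) (2 * ε')
  have h₃ := thetaHol_two_mul ε ε'
  have h₄ := thetaHol_two_mul_add_one ε ε'
  have h₅ := thetaHol_sq 0 0
  have h₆ := thetaHol_sq_add_one_right 0 0
  have hexp : exp (Real.pi * I * (2 * ε : ℝ)) = exp (Real.pi * I * ε) ^ 2 := by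
    rw [← exp_nat_mul]; congr 1; push_cast; ring
  rw [hexp] at h₂
  rw [zero_add, ofReal_zero, mul_zero, exp_zero, one_smul] at h₆
  set a := kummerFst 0 0
  set b := kummerSnd 0 0
  set A := kummerFst ε ε'
  set B := kummerSnd ε ε'
  set A' := kummerFst (2 * ε) (2 * ε')
  set B' := kummerSnd (2 * ε) (2 * ε')
  set c := exp (Real.pi * I * ε)
  have hc : c ≠ 0 := exp_ne_zero _
  have k₁ : (A ^ 2 + B ^ 2) ^ 2 = (a * A' + b * B') * (a ^ 2 + b ^ 2) := by
    rw [← h₃, mul_pow, h₁, h₅]; ring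
  have k₂ : (A ^ 2 - B ^ 2) ^ 2 = (a * A' - b * B') * (a ^ 2 - b ^ 2) := by
    have := congrArg (· ^ 2) h₄
    simp only [mul_pow, smul_pow, h₂, h₆, smul_mul_assoc] at this
    rw [← smul_right_injective _ (pow_ne_zero 2 hc) this]
    ring
  ext1
  · simp only [kummerDouble, k₁, k₂, Prod.smul_fst, smul_eq_mul]; ring
  · simp only [kummerDouble, k₁, k₂, Prod.smul_snd, smul_eq_mul]; ring

/-! ### Points of order five -/

/-- The coordinates of the origin, and the factor lost in `kummerDouble`, are nonzero: this
amounts to the nonvanishing of four theta constants. -/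
theorem kummer_origin_ne_zero :
    2 * kummerFst 0 0 * kummerSnd 0 0 * (kummerFst 0 0 ^ 4 - kummerSnd 0 0 ^ 4) ≠ 0 := by
  have e : kummerFst 0 0 ^ 4 - kummerSnd 0 0 ^ 4 = thetaHol 0 0 ^ 2 * thetaHol 0 1 ^ 2 := by
    have h₆ := thetaHol_sq_add_one_right 0 0
    rw [zero_add, ofReal_zero, mul_zero, exp_zero, one_smul] at h₆
    rw [thetaHol_sq, h₆]
    ring
  have apply_ne {f : holomorphicFunctions} (τ : ℍ) (h : (f : ℍ → ℂ) τ ≠ 0) : f ≠ 0 := by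
    rintro rfl
    exact h rfl
  have h2 : (2 * ((UpperHalfPlane.I : ℍ) : ℂ)) = ((2 : ℝ) : ℂ) * Complex.I := by simp
  rw [e]
  refine mul_ne_zero (mul_ne_zero (mul_ne_zero ?_ ?_) ?_)
    (mul_ne_zero (pow_ne_zero 2 ?_) (pow_ne_zero 2 ?_))
  · refine apply_ne UpperHalfPlane.I ?_
    exact two_ne_zero (α := ℂ)
  · refine apply_ne UpperHalfPlane.I ?_
    change thetaNull 0 (2 * 0) _ ≠ 0
    rw [h2, mul_zero]
    exact thetaNull_zero_right_ne_zero 0 two_pos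
  · refine apply_ne UpperHalfPlane.I ?_
    change thetaNull (0 + 1) (2 * 0) _ ≠ 0
    rw [h2, mul_zero]
    exact thetaNull_zero_right_ne_zero _ two_pos
  · refine apply_ne UpperHalfPlane.I ?_
    simpa [thetaHol, thetaConst_apply] using thetaNull_zero_right_ne_zero 0 one_pos
  · refine apply_ne ⟨1 + Complex.I, by simp⟩ ?_
    exact thetaNull_zero_one_ne_zero

/-- For a point of order five, four times the point is its negative, up to a lattice vector. The
factor `exp (-2 π i n ε)`, `ε = 2 * m / 5`, is the same for `kummerSnd`. -/
theorem kummerFst_four_mul (m n : ℤ) : kummerFst (2 * (2 * (2 * m / 5))) (2 * (2 * (2 * n / 5))) =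
    exp (-(2 * Real.pi * I * n * (2 * m / 5))) • kummerFst (2 * m / 5) (2 * n / 5) := by
  ext τ
  have e : 2 * (2 * (2 * (m : ℝ) / 5)) = -(2 * m / 5) + 2 * m := by ring
  have e' : 2 * (2 * (2 * (2 * (n : ℝ) / 5))) = -(2 * (2 * n / 5)) + 2 * (2 * n : ℤ) := by
    push_cast; ring
  change thetaNull _ _ _ = _ * thetaNull _ _ _
  rw [e, e', thetaNull_add_two_mul_int, thetaNull_add_two_mul_int_right, thetaNull_neg]
  congr 2
  push_cast
  ring

theorem kummerSnd_four_mul (m n : ℤ) : kummerSnd (2 * (2 * (2 * m / 5))) (2 * (2 * (2 * n / 5))) =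
    exp (-(2 * Real.pi * I * n * (2 * m / 5))) • kummerSnd (2 * m / 5) (2 * n / 5) := by
  ext τ
  have e : 2 * (2 * (2 * (m : ℝ) / 5)) + 1 = -(2 * m / 5 + 1) + 2 * (m + 1 : ℤ) := by
    push_cast; ring
  have e' : 2 * (2 * (2 * (2 * (n : ℝ) / 5))) = -(2 * (2 * n / 5)) + 2 * (2 * n : ℤ) := by
    push_cast; ring
  change thetaNull _ _ _ = _ * thetaNull _ _ _
  rw [e, e', thetaNull_add_two_mul_int, thetaNull_add_two_mul_int_right, thetaNull_neg]
  congr 1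
  rw [exp_eq_exp_iff_exists_int]
  -- The characteristic `ε + 1` instead of `ε` changes the exponent by `-2 π i n`.
  refine ⟨-n, ?_⟩
  push_cast
  ring

/-- The Kummer coordinates of a point of order five are algebraic over those of the origin. -/
theorem isAlgebraic_kummer_five_torsion (m n : ℤ) :
    IsAlgebraic (Algebra.adjoin ℂ {kummerFst 0 0, kummerSnd 0 0})
      (kummerFst (2 * m / 5) (2 * n / 5)) ∧
    IsAlgebraic (Algebra.adjoin ℂ {kummerFst 0 0, kummerSnd 0 0})
      (kummerSnd (2 * m / 5) (2 * n / 5)) := by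
  have h := kummerDouble_kummer (2 * (2 * m / 5)) (2 * (2 * n / 5))
  have h' := congrArg (kummerDouble (kummerFst 0 0) (kummerSnd 0 0))
    (kummerDouble_kummer (2 * m / 5) (2 * n / 5))
  rw [kummerDouble_smul, h, kummerFst_four_mul, kummerSnd_four_mul, ← Prod.smul_mk, smul_smul,
    ← pow_succ] at h'
  exact isAlgebraic_adjoin_of_kummerDouble kummer_origin_ne_zero (exp_ne_zero _) (_, _) h'

/-- The square of `θ[ε + 1; ε' + 1]` is a linear form in the Kummer coordinates of `(ε, ε')`. -/
theorem isAlgebraic_thetaHol (m n : ℤ) :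
    IsAlgebraic (Algebra.adjoin ℂ {kummerFst 0 0, kummerSnd 0 0})
      (thetaHol (2 * m / 5 + 1) (2 * n / 5 + 1)) := by
  obtain ⟨hA, hB⟩ := isAlgebraic_kummer_five_torsion m n
  have h0 := isAlgebraic_kummer_five_torsion 0 0
  simp only [Int.cast_zero, mul_zero, zero_div] at h0
  refine IsAlgebraic.of_pow two_pos ?_
  rw [thetaHol_sq_add_one_add_one,
    ← algebraMap_smul (Algebra.adjoin ℂ {kummerFst 0 0, kummerSnd 0 0}) (exp _)]
  exact ((h0.2.mul hA).sub (h0.1.mul hB)).smul _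

/-- Each of the twelve theta constants has a characteristic `(1, 1) + (ε, ε')` with `(ε, ε')`
a point of order five; for instance `j / 5 = 1 + 2 * m / 5` with `m = (j - 5) / 2`. -/
theorem levelFiveThetaConst_eq (i : (Fin 2 × Fin 5) ⊕ Fin 2) : ∃ m n : ℤ,
    levelFiveThetaConst i = thetaHol (2 * m / 5 + 1) (2 * n / 5 + 1) := by
  rcases i with ⟨p, q⟩ | p
  · refine ⟨p - 2, q - 2, ?_⟩
    change thetaConst _ _ = thetaConst _ _
    congr 1 <;> push_cast <;> ring
  · refine ⟨0, p - 2, ?_⟩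
    change thetaConst _ _ = thetaConst _ _
    congr 1 <;> push_cast <;> ring

theorem mainTheorem1 (s : Finset ((Fin 2 × Fin 5) ⊕ Fin 2))
    (hs : AlgebraicIndependent ℂ
      (fun i : {i : (Fin 2 × Fin 5) ⊕ Fin 2 // i ∈ s} => levelFiveThetaConst i.1)) :
    s.card ≤ 5 := by
  classical
  choose m n hmn using levelFiveThetaConst_eq
  -- Independence is tested in the domain of holomorphic functions, and the bound there is `2`.
  let x : {i // i ∈ s} → holomorphicFunctions := fun i =>
    thetaHol (2 * m i.1 / 5 + 1) (2 * n i.1 / 5 + 1)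
  have hx : AlgebraicIndependent ℂ x := by
    refine AlgebraicIndependent.of_comp holomorphicFunctions.val ?_
    convert hs using 1
    funext i
    exact (hmn i.1).symm
  have h := hx.card_le_two_of_isAlgebraic_adjoin_pair
    (fun i => isAlgebraic_thetaHol (m i.1) (n i.1))
  rw [Fintype.card_coe] at h
  exact h.trans (by norm_num)
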